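/- Let $d\ge 1$. A convex body in $\mathbb{R}^d$ is a convex compact set with nonempty interior; a homothet of $C$ is a set $\lambda C+x$ with $\lambda>0$ and $x\in\mathbb{R}^d$. There is a constant $c_d>0$, depending only on $d$, such that the following two statements hold for every convex body $C\subset\mathbb{R}^d$. (1) Let $k$ be a positive integer and let $S\subset\mathbb{R}^d$ be a finite set such that the boundary of every homothet of $C$ contains at most $k/2$ points of $S$ (that is, $S$ is non-$\frac k2/C$-degenerate). Let $f(C,k,S)$ be the least number of homothets of $C$, each containing at most $k$ points of $S$, whose union covers $S$. Then $f(C,k,S)$ is finite and $$f(C,k,S)\le c_d\,\max\{1,|S|/k\}.$$ In particular $f(C,k,S)\le c_d\,|S|/k$ whenever $|S|\ge k$. (2) Let $k$ be a positive real number and let $\mu$ be a $C$-nice measure, that is, a finite Borel measure on $\mathbb{R}^d$ that vanishes on the boundary of every homothet of $C$ and satisfies $\mu(K)=\mu(\mathbb{R}^d)$ for some ball $K$ of positive radius (open or closed). For any such ball $K$, let $f(C,k,\mu)$ be the least number of homothets of $C$, each of $\mu$-measure at most $k$, whose union covers $K$. Then, for every choice of $K$, $f(C,k,\mu)$ is finite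 and $$f(C,k,\mu)\le c_d\,\max\{1,\mu(\mathbb{R}^d)/k\}.$$ In particular $f(C,k,\mu)\le c_d\,\mu(\mathbb{R}^d)/k$ whenever $\mu(\mathbb{R}^d)\ge k$. -/

import Mathlib

open MeasureTheory

/-- `ℝ^d` with the Euclidean norm. -/
abbrev Eucl (d : ℕ) : Type := EuclideanSpace ℝ (Fin d)

/-- A convex body in `ℝ^d`: a convex compact set with nonempty interior. -/
structure IsConvexBody {d : ℕ} (C : Set (Eucl d)) : Prop where
  convex : Convex ℝ C
  isCompact : IsCompact C
  interior_nonempty : (interior C).Nonempty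

/-- `H` is a (positive) homothet of `C`: a set `{l c + x : c ∈ C}` with `l > 0`. -/
def IsHomothet {d : ℕ} (C H : Set (Eucl d)) : Prop :=
  ∃ (l : ℝ) (x : Eucl d), 0 < l ∧ H = (fun c => l • c + x) '' C

/-- `S` is non-`t/C`-degenerate: the boundary of any homothet of `C` contains at most `t`
elements of `S`. -/
def NonDegenerate {d : ℕ} (t : ℝ) (C : Set (Eucl d)) (S : Finset (Eucl d)) : Prop :=
  ∀ H : Set (Eucl d), IsHomothet C H → (((S : Set (Eucl d)) ∩ frontier H).ncard : ℝ) ≤ t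

/-- `K` is a ball of positive radius, open or closed. -/
def IsBall {d : ℕ} (K : Set (Eucl d)) : Prop :=
  ∃ (x : Eucl d) (r : ℝ), 0 < r ∧ (K = Metric.ball x r ∨ K = Metric.closedBall x r)

/-- A Borel measure is `C`-nice if it is finite, vanishes on the boundary of every homothet
of `C`, and is concentrated on some ball. -/
structure IsNice {d : ℕ} (C : Set (Eucl d)) (μ : Measure (Eucl d)) : Prop where
  finite : μ Set.univ < ⊤
  frontier_null : ∀ H : Set (Eucl d), IsHomothet C H → μ (frontier H) = 0
  exists_ball : ∃ K : Set (Eucl d), IsBall K ∧ μ K = μ Set.univ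

/-- The least number of sets satisfying `P` whose union covers `A`
(`⊤` if there is no finite such cover). -/
noncomputable def coverNumber {d : ℕ} (P : Set (Eucl d) → Prop) (A : Set (Eucl d)) : ℕ∞ :=
  ⨅ (F : Set (Set (Eucl d))) (_ : ∀ H ∈ F, P H) (_ : A ⊆ ⋃₀ F), F.encard

/-- `f(C, k, S)`: the least number of homothets of `C`, each containing at most `k` points
of `S`, that cover `S`. -/
noncomputable def fPoints {d : ℕ} (C : Set (Eucl d)) (k : ℕ) (S : Finset (Eucl d)) : ℕ∞ :=
  coverNumber (fun H => IsHomothet C H ∧ ((S : Set (Eucl d)) ∩ H).ncard ≤ k) S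

/-- `f(C, k, μ)`, with its dependence on the ball `K` on which `μ` is concentrated made
explicit: the least number of homothets of `C`, each of measure at most `k`, that cover `K`. -/
noncomputable def fMeasure {d : ℕ} (C : Set (Eucl d)) (k : ℝ) (μ : Measure (Eucl d))
    (K : Set (Eucl d)) : ℕ∞ :=
  coverNumber (fun H => IsHomothet C H ∧ μ H ≤ ENNReal.ofReal k) K

/-! Both statements are cases of one covering result for a finite measure that gives homothet
boundaries mass at most `k / 2`; for points, the measure is counting on `S`. If the total mass is at
most `k`, one large homothet suffices. Otherwise each point `x` is the centre of a homothet of mass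
between `k / 4` and `k` (`exists_quantile`). Pick centres greedily, each outside the homothets
already chosen and with radius at least half the supremum available. A Besicovitch-type argument
(`exists_overlap_bound`) shows that no point lies in more than `N` chosen homothets, so `m` of them
satisfy `m * k / 4 ≤ N * μ(ℝ^d)`. The selection therefore stops, and it stops only when everything
is covered. `N` depends only on `d`: a maximal-volume simplex gives linear coordinates in which the
gauge of `C` is comparable with the sup norm up to the factor `4 * d`. -/

/-! ### Bounded overlap for gauge balls -/

theorem exists_finite_coloring_closedBall {E : Type*} [NormedAddCommGroup E] [ProperSpace E]
    (R : ℝ) {ε : ℝ} (hε : 0 < ε) :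
    ∃ (n : ℕ) (f : E → Fin n), ∀ x y : E, ‖x‖ ≤ R → ‖y‖ ≤ R → f x = f y → ‖x - y‖ < ε := by
  classical
  obtain ⟨t, ht, hcov⟩ := Metric.totallyBounded_iff.1
    (isCompact_closedBall (0 : E) R).totallyBounded (ε / 2) (half_pos hε)
  have hex : ∀ x : E, ∃ y : Option ht.toFinset,
      ‖x‖ ≤ R → ∃ c : ht.toFinset, y = some c ∧ ‖x - c‖ < ε / 2 := by
    intro x
    by_cases hx : ‖x‖ ≤ R
    · have := hcov (mem_closedBall_zero_iff.2 hx)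
      simp only [Set.mem_iUnion, Metric.mem_ball, dist_eq_norm, exists_prop] at this
      obtain ⟨c, hc, hxc⟩ := this
      exact ⟨some ⟨c, ht.mem_toFinset.2 hc⟩, fun _ => ⟨_, rfl, hxc⟩⟩
    · exact ⟨none, fun h => absurd h hx⟩
  choose f hf using hex
  refine ⟨_, fun x => Fintype.equivFin _ (f x), fun x y hx hy hxy => ?_⟩
  have hxy : f x = f y := (Fintype.equivFin _).injective hxy
  obtain ⟨c, hc, hxc⟩ := hf x hx
  obtain ⟨c', hc', hyc⟩ := hf y hy
  have hcc : c = c' := by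
    rw [hxy, hc'] at hc
    exact (Option.some.inj hc).symm
  subst hcc
  have : x - y = (x - c) - (y - c) := by abel
  rw [this]
  linarith [norm_sub_le (x - (c : E)) (y - c)]

/-- A gauge: a subadditive, positively homogeneous function that is comparable with the norm. -/
structure IsGaugeLike {E : Type*} [NormedAddCommGroup E] [NormedSpace ℝ E] (D : ℝ) (p : E → ℝ) :
    Prop where
  add_le : ∀ v w, p (v + w) ≤ p v + p w
  smul : ∀ (t : ℝ) (v : E), 0 ≤ t → p (t • v) = t * p v
  le_norm : ∀ v, p v ≤ ‖v‖
  norm_le : ∀ v, ‖v‖ ≤ D * p v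

/-- If `u` and `v` point in nearly the same direction and `‖v‖ ≤ ‖u‖`, then `v - u` is no longer
than `-u`, up to the given bound. -/
theorem IsGaugeLike.sub_le_of_direction {E : Type*} [NormedAddCommGroup E] [NormedSpace ℝ E]
    {D : ℝ} (hD : 0 < D) {p : E → ℝ} (hp : IsGaugeLike D p) {u v : E} {r : ℝ}
    (hu : p (-u) ≤ r) (hvu : ‖v‖ ≤ ‖u‖)
    (hdir : ‖‖v‖⁻¹ • v - ‖u‖⁻¹ • u‖ ≤ D⁻¹) : p (v - u) ≤ r := by
  have hur : ‖u‖ ≤ D * r := by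
    have := hp.norm_le (-u)
    rw [norm_neg] at this
    exact this.trans (by gcongr)
  rcases eq_or_ne u 0 with rfl | hu0
  · have : v = 0 := by simpa using hvu
    simpa [this] using hu
  have hun : 0 < ‖u‖ := norm_pos_iff.2 hu0
  have hvv : ‖v‖ • (‖v‖⁻¹ • v) = v := by
    rcases eq_or_ne v 0 with rfl | hv0
    · simp
    · rw [smul_smul, mul_inv_cancel₀ (norm_ne_zero_iff.2 hv0), one_smul]
  -- With `t = ‖v‖ / ‖u‖`, the first term has gauge at most `(1 - t) * r`; the second is a small
  -- direction error, at most `t * r` because `‖u‖ ≤ D * r`.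
  have hdec : v - u = (1 - ‖v‖ / ‖u‖) • (-u) + ‖v‖ • (‖v‖⁻¹ • v - ‖u‖⁻¹ • u) := by
    rw [smul_sub, hvv, smul_smul, sub_smul, one_smul, div_eq_mul_inv, smul_neg]
    abel
  have hq : ‖v‖ / ‖u‖ ≤ 1 := (div_le_one hun).2 hvu
  calc p (v - u) ≤ p ((1 - ‖v‖ / ‖u‖) • (-u)) + p (‖v‖ • (‖v‖⁻¹ • v - ‖u‖⁻¹ • u)) := by
        conv_lhs => rw [hdec]
        exact hp.add_le _ _
    _ ≤ (1 - ‖v‖ / ‖u‖) * r + ‖v‖ * D⁻¹ := by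
        rw [hp.smul _ _ (by linarith), hp.smul _ _ (norm_nonneg v)]
        have := (hp.le_norm _).trans hdir
        gcongr
    _ ≤ (1 - ‖v‖ / ‖u‖) * r + ‖v‖ / ‖u‖ * r := by
        have : D⁻¹ ≤ r / ‖u‖ := by
          rw [inv_eq_one_div, div_le_div_iff₀ hD hun]
          linarith
        have h2 : ‖v‖ / ‖u‖ * r = ‖v‖ * (r / ‖u‖) := by ring
        rw [h2]
        gcongr
    _ = r := by ring

/-- Two pigeonholes, neither depending on `p`. Among centres seen from `z` in nearly the same
direction, distances to `z` increase with the index, which makes all radii comparable with the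
first. The rescaled centres are then separated points of a fixed ball. -/
theorem exists_overlap_bound {E : Type*} [NormedAddCommGroup E] [NormedSpace ℝ E] [ProperSpace E]
    {D : ℝ} (hD : 0 < D) :
    ∃ N : ℕ, ∀ p : E → ℝ, IsGaugeLike D p → ∀ (x : ℕ → E) (r : ℕ → ℝ) (z : E) (s : Finset ℕ),
      (∀ i ∈ s, 0 < r i) → (∀ i ∈ s, p (z - x i) ≤ r i) →
      (∀ i ∈ s, ∀ j ∈ s, i < j → r i < p (x j - x i)) →
      (∀ i ∈ s, ∀ j ∈ s, i < j → r j ≤ 2 * r i) → s.card ≤ N := by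
  classical
  obtain ⟨n, f, hf⟩ := exists_finite_coloring_closedBall (E := E) 1 (inv_pos.2 hD)
  obtain ⟨m, g, hg⟩ := exists_finite_coloring_closedBall (E := E) (2 * D)
    (ε := (2 * D)⁻¹) (by positivity)
  refine ⟨n * (m + 1), fun p hp x r z s hr hz hx hrr => ?_⟩
  by_contra! hcard
  set u : ℕ → E := fun i => x i - z
  have huu : ∀ i j, x j - x i = u j - u i := fun i j => by simp [u]
  have hzu : ∀ i, z - x i = -u i := fun i => by simp [u]
  simp only [huu] at hx
  simp only [hzu] at hz
  obtain ⟨c, -, hc⟩ := Finset.exists_lt_card_fiber_of_mul_lt_card_of_maps_to (s := s)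
    (t := Finset.univ) (f := fun i => f (‖u i‖⁻¹ • u i)) (n := m + 1) (by simp) (by simpa using hcard)
  set s' := s.filter fun i => f (‖u i‖⁻¹ • u i) = c
  have hs' : ∀ i ∈ s', i ∈ s ∧ f (‖u i‖⁻¹ • u i) = c := fun i hi => Finset.mem_filter.1 hi
  have hunit : ∀ i, ‖‖u i‖⁻¹ • u i‖ ≤ 1 := fun i => by
    rw [norm_smul, norm_inv, norm_norm]
    exact inv_mul_le_one
  -- A later centre no farther from `z` in this direction would lie in the earlier ball.
  have hlt : ∀ i ∈ s', ∀ j ∈ s', i < j → ‖u i‖ < ‖u j‖ := by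
    intro i hi j hj hij
    by_contra! hle
    have := hp.sub_le_of_direction hD (hz i (hs' i hi).1) hle
      (hf _ _ (hunit j) (hunit i) ((hs' j hj).2.trans (hs' i hi).2.symm)).le
    linarith [hx i (hs' i hi).1 j (hs' j hj).1 hij]
  have hne : s'.Nonempty := Finset.card_pos.1 (by omega)
  set i₀ := s'.min' hne
  have hi₀ : i₀ ∈ s' := s'.min'_mem hne
  have hR : 0 < r i₀ := hr _ (hs' _ hi₀).1
  -- The lower bound on `r j` comes from `r i₀ < ‖u j‖ + ‖u i₀‖ < 2 * ‖u j‖`, the upper bound on `‖u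
  -- j‖` from `r j ≤ 2 * r i₀`.
  have hbig : ∀ j ∈ s'.erase i₀, i₀ < j ∧ r i₀ < 2 * D * r j ∧ ‖u j‖ ≤ 2 * D * r i₀ := by
    intro j hj
    have hjs := Finset.mem_of_mem_erase hj
    have hij : i₀ < j := lt_of_le_of_ne (s'.min'_le j hjs) (Finset.ne_of_mem_erase hj).symm
    have h1 := hx i₀ (hs' _ hi₀).1 j (hs' j hjs).1 hij
    have h2 := (hp.le_norm _).trans (norm_sub_le (u j) (u i₀))
    have h3 := hlt _ hi₀ _ hjs hij
    have h4 : ‖u j‖ ≤ D * r j := by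
      have := hp.norm_le (-u j)
      rw [norm_neg] at this
      exact this.trans (mul_le_mul_of_nonneg_left (hz j (hs' j hjs).1) hD.le)
    have h5 := mul_le_mul_of_nonneg_left (hrr _ (hs' _ hi₀).1 j (hs' j hjs).1 hij) hD.le
    exact ⟨hij, by linarith, by linarith⟩
  have hcard' : (Finset.univ : Finset (Fin m)).card < (s'.erase i₀).card := by
    rw [Finset.card_erase_of_mem hi₀, Finset.card_univ, Fintype.card_fin]
    omega
  obtain ⟨i, hi, j, hj, hij, hgij⟩ := Finset.exists_ne_map_eq_of_card_lt_of_maps_to hcard'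
    (f := fun i => g ((r i₀)⁻¹ • u i)) (by simp [Set.MapsTo])
  wlog hlt' : i < j generalizing i j
  · exact this j hj i hi hij.symm hgij.symm (lt_of_le_of_ne (not_lt.1 hlt') hij.symm)
  have hscale : ∀ j ∈ s'.erase i₀, ‖(r i₀)⁻¹ • u j‖ ≤ 2 * D := by
    intro j hj
    rw [norm_smul, norm_inv, Real.norm_of_nonneg hR.le, inv_mul_le_iff₀ hR]
    linarith [(hbig j hj).2.2]
  have h1 := hg _ _ (hscale j hj) (hscale i hi) hgij.symm
  rw [← smul_sub, norm_smul, norm_inv, Real.norm_of_nonneg hR.le, inv_mul_lt_iff₀ hR] at h1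
  have h2 := hx i (hs' i (Finset.mem_of_mem_erase hi)).1 j
    (hs' j (Finset.mem_of_mem_erase hj)).1 hlt'
  have h3 := (hbig i hi).2.1
  have h4 : r i₀ * (2 * D)⁻¹ < r i := by
    rw [← div_eq_mul_inv, div_lt_iff₀ (by positivity)]
    linarith
  linarith [hp.le_norm (u j - u i)]

/-! ### Mass counting, greedy selection and quantiles -/

/-- If no point lies in more than `N` members of a finite family, the measures of the members sum
to at most `N` times the total measure. -/
theorem sum_measure_le_of_overlap {α ι : Type*} [MeasurableSpace α] (μ : Measure α)
    (s : Finset ι) (A : ι → Set α) (hA : ∀ i ∈ s, MeasurableSet (A i)) (N : ℕ)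
    (hN : ∀ z, ∀ t ⊆ s, (∀ i ∈ t, z ∈ A i) → t.card ≤ N) :
    ∑ i ∈ s, μ (A i) ≤ N * μ Set.univ := by
  classical
  calc ∑ i ∈ s, μ (A i) = ∑ i ∈ s, ∫⁻ z, (A i).indicator 1 z ∂μ :=
        Finset.sum_congr rfl fun i hi => (lintegral_indicator_one (hA i hi)).symm
    _ = ∫⁻ z, ∑ i ∈ s, (A i).indicator 1 z ∂μ :=
        (lintegral_finsetSum' _ fun i hi =>
          (measurable_one.indicator (hA i hi)).aemeasurable).symm
    _ ≤ ∫⁻ _, (N : ENNReal) ∂μ := by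
        refine lintegral_mono fun z => ?_
        have := hN z (s.filter fun i => z ∈ A i) (Finset.filter_subset _ _) (by simp)
        simp only [Set.indicator_apply, Pi.one_apply, Finset.sum_boole]
        exact_mod_cast this
    _ = N * μ Set.univ := lintegral_const _

/-- A greedy selection: either finitely many selected points capture all of `S`, or the selection
can be continued to any length. -/
theorem exists_greedy_selection {α : Type*} [Inhabited α] (S : Set α) (R : α → α → Prop)
    (r : α → ℝ) (hr : ∀ a ∈ S, 0 < r a) (hbdd : BddAbove (r '' S)) (n : ℕ) :
    ∃ (m : ℕ) (x : ℕ → α), m ≤ n ∧ (∀ i < m, x i ∈ S) ∧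
      (∀ i j, i < j → j < m → ¬ R (x i) (x j)) ∧
      (∀ i < m, ∀ y ∈ S, (∀ j < i, ¬ R (x j) y) → r y ≤ 2 * r (x i)) ∧
      (m = n ∨ ∀ y ∈ S, ∃ i < m, R (x i) y) := by
  classical
  induction n with
  | zero => exact ⟨0, fun _ => default, le_rfl, by simp, by simp, by simp, Or.inl rfl⟩
  | succ n ih =>
    obtain ⟨m, x, hmn, hxS, hxR, hxr, hcov⟩ := ih
    by_cases hc : ∀ y ∈ S, ∃ i < m, R (x i) y
    · exact ⟨m, x, by omega, hxS, hxR, hxr, Or.inr hc⟩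
    obtain rfl : m = n := hcov.resolve_right hc
    set U := {y ∈ S | ∀ i < m, ¬ R (x i) y}
    have hU : U.Nonempty := by
      push Not at hc
      obtain ⟨y, hy, h⟩ := hc
      exact ⟨y, hy, h⟩
    have hUb : BddAbove (r '' U) := hbdd.mono (Set.image_mono fun y hy => hy.1)
    obtain ⟨a, ha⟩ := hU
    have hpos : 0 < sSup (r '' U) := (hr a ha.1).trans_le (le_csSup hUb ⟨a, ha, rfl⟩)
    -- The supremum need not be attained; half of it is exceeded.
    obtain ⟨_, ⟨b, hb, rfl⟩, hbs⟩ := exists_lt_of_lt_csSup (⟨_, a, ha, rfl⟩ : (r '' U).Nonempty)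
      (half_lt_self hpos)
    have hx' : ∀ i < m, Function.update x m b i = x i := fun i hi =>
      Function.update_of_ne hi.ne _ _
    have hxm : Function.update x m b m = b := Function.update_self _ _ _
    refine ⟨m + 1, Function.update x m b, le_rfl, ?_, ?_, ?_, Or.inl rfl⟩
    · intro i hi
      rcases Nat.lt_succ_iff_lt_or_eq.1 hi with h | rfl
      · rw [hx' i h]; exact hxS i h
      · rw [hxm]; exact hb.1
    · intro i j hij hj
      rw [hx' i (by omega)]
      rcases Nat.lt_succ_iff_lt_or_eq.1 hj with h | rfl
      · rw [hx' j h]; exact hxR i j hij h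
      · rw [hxm]; exact hb.2 i hij
    · intro i hi y hy h
      rcases Nat.lt_succ_iff_lt_or_eq.1 hi with hi' | rfl
      · rw [hx' i hi']
        refine hxr i hi' y hy fun j hj => ?_
        have := h j hj
        rwa [hx' j (by omega)] at this
      · rw [hxm]
        have hyU : y ∈ U := ⟨hy, fun j hj => by
          have := h j hj
          rwa [hx' j hj] at this⟩
        linarith [le_csSup hUb ⟨y, hyU, rfl⟩]

/-- A quantile lemma: a finite measure on the nonnegative reals without atoms heavier than `k / 2`
has an initial segment of measure between `k / 4` and `k`. -/
theorem exists_quantile (m : Measure ℝ) [IsFiniteMeasure m] {k : ℝ} (hk : 0 < k)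
    (hneg : m (Set.Iio 0) = 0) (hatom : ∀ t, m {t} ≤ ENNReal.ofReal (k / 2))
    (huniv : ENNReal.ofReal k < m Set.univ) :
    ∃ t, 0 < t ∧ m (Set.Iic t) ≤ ENNReal.ofReal k ∧ ENNReal.ofReal (k / 4) ≤ m (Set.Iic t) := by
  set T := {t | ENNReal.ofReal k < m (Set.Iic t)}
  have hne : T.Nonempty := ((tendsto_measure_Iic_atTop m).eventually (lt_mem_nhds huniv)).exists
  have hatom0 : m (Set.Iic 0) ≤ ENNReal.ofReal (k / 2) := by
    rw [← Set.Iio_union_right]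
    refine (measure_union_le _ _).trans ?_
    rw [hneg, zero_add]
    exact hatom 0
  have hk2 : ENNReal.ofReal (k / 2) < ENNReal.ofReal k :=
    (ENNReal.ofReal_lt_ofReal_iff hk).2 (half_lt_self hk)
  have hlb : ∀ t ∈ T, 0 ≤ t := by
    intro t ht
    by_contra! h
    exact absurd ((measure_mono (Set.Iic_subset_Iic.2 h.le)).trans hatom0)
      (not_le.2 (hk2.trans ht))
  have hbdd : BddBelow T := ⟨0, hlb⟩
  set q := sInf T
  have hlow : ∀ t < q, m (Set.Iic t) ≤ ENNReal.ofReal k := fun t ht =>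
    not_lt.1 fun h => absurd (csInf_le hbdd h) (not_le.2 ht)
  have hright : ENNReal.ofReal k ≤ m (Set.Iic q) := by
    have hq : Set.Iic q = ⋂ n : ℕ, Set.Iic (q + 1 / ((n : ℝ) + 1)) := by
      ext y
      simp only [Set.mem_Iic, Set.mem_iInter]
      refine ⟨fun h n => h.trans (by linarith [Nat.one_div_pos_of_nat (α := ℝ) (n := n)]), fun h => ?_⟩
      refine le_of_forall_pos_le_add fun ε hε => ?_
      obtain ⟨n, hn⟩ := exists_nat_one_div_lt hε
      linarith [h n]
    have hanti : Antitone fun n : ℕ => Set.Iic (q + 1 / ((n : ℝ) + 1)) := by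
      intro a b hab
      refine Set.Iic_subset_Iic.2 ?_
      have := Nat.one_div_le_one_div (α := ℝ) hab
      linarith
    rw [hq]
    refine ge_of_tendsto' (tendsto_measure_iInter_atTop
      (fun n => measurableSet_Iic.nullMeasurableSet) hanti ⟨0, measure_ne_top _ _⟩) fun n => ?_
    obtain ⟨t, ht, htq⟩ := exists_lt_of_csInf_lt hne
      (show q < q + 1 / ((n : ℝ) + 1) by linarith [Nat.one_div_pos_of_nat (α := ℝ) (n := n)])
    exact (le_of_lt ht).trans (measure_mono (Set.Iic_subset_Iic.2 htq.le))
  have hq0 : 0 < q := by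
    refine lt_of_le_of_ne (le_csInf hne hlb) fun h => ?_
    rw [← h] at hright
    exact absurd (hright.trans hatom0) (not_le.2 hk2)
  -- Removing the atom at `q` leaves at least `k / 2`; the slack down to `k / 4` lets some closed
  -- segment ending before `q` do.
  have hleft : ENNReal.ofReal (k / 4) < m (Set.Iio q) := by
    by_contra! h
    have h1 : m (Set.Iic q) ≤ ENNReal.ofReal (k / 4) + ENNReal.ofReal (k / 2) := by
      rw [← Set.Iio_union_right]
      exact (measure_union_le _ _).trans (add_le_add h (hatom q))
    rw [← ENNReal.ofReal_add (by positivity) (by positivity)] at h1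
    have := (ENNReal.ofReal_le_ofReal_iff (by positivity)).1 (hright.trans h1)
    linarith
  have hq : Set.Iio q = ⋃ n : ℕ, Set.Iic (q - 1 / ((n : ℝ) + 1)) := by
    ext y
    simp only [Set.mem_Iio, Set.mem_Iic, Set.mem_iUnion]
    refine ⟨fun h => ?_, fun ⟨n, h⟩ => by linarith [Nat.one_div_pos_of_nat (α := ℝ) (n := n)]⟩
    obtain ⟨n, hn⟩ := exists_nat_one_div_lt (sub_pos.2 h)
    exact ⟨n, by linarith⟩
  have hmono : Monotone fun n : ℕ => Set.Iic (q - 1 / ((n : ℝ) + 1)) := by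
    intro a b hab
    refine Set.Iic_subset_Iic.2 ?_
    have := Nat.one_div_le_one_div (α := ℝ) hab
    linarith
  rw [hq] at hleft
  obtain ⟨n, hn⟩ := ((tendsto_measure_iUnion_atTop hmono).eventually
    (lt_mem_nhds hleft)).exists
  set t := q - 1 / ((n : ℝ) + 1)
  have htq : t < q := by
    have := Nat.one_div_pos_of_nat (α := ℝ) (n := n)
    simp only [t]; linarith
  refine ⟨max t (q / 2), lt_max_of_lt_right (half_pos hq0), hlow _ (max_lt htq (half_lt_self hq0)),
    hn.le.trans (measure_mono (Set.Iic_subset_Iic.2 (le_max_left _ _)))⟩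

/-! ### Normalising a convex body -/

/-- A convex body contains `d` points, spanning together with a given interior point `a` a simplex
of maximal volume; the corresponding coordinates of the body lie in `[-1, 1]`. -/
theorem IsConvexBody.exists_basis {d : ℕ} {C : Set (Eucl d)} (hC : IsConvexBody C) {a : Eucl d}
    (ha : a ∈ interior C) :
    ∃ b : Module.Basis (Fin d) ℝ (Eucl d), (∀ i, a + b i ∈ C) ∧
      ∀ y ∈ C, ∀ i, |b.equivFun (y - a) i| ≤ 1 := by
  classical
  set e := (EuclideanSpace.basisFun (Fin d) ℝ).toBasis
  have hcont : Continuous fun v : Fin d → Eucl d => |e.det fun i => v i - a| := by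
    simp only [Module.Basis.det_apply]
    refine (Continuous.matrix_det ?_).abs
    refine continuous_matrix fun i j => ?_
    simp only [Module.Basis.toMatrix_apply, e, OrthonormalBasis.coe_toBasis_repr_apply,
      EuclideanSpace.basisFun_repr]
    fun_prop
  have hKc : IsCompact (Set.univ.pi fun _ : Fin d => C) := isCompact_univ_pi fun _ => hC.isCompact
  have haC : a ∈ C := interior_subset ha
  obtain ⟨w, hw, hmax⟩ := hKc.exists_isMaxOn ⟨fun _ => a, fun _ _ => haC⟩ hcont.continuousOn
  have hpos : 0 < |e.det fun i => w i - a| := by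
    have hev : ∀ᶠ t : ℝ in nhdsWithin 0 (Set.Ioi 0), ∀ i, a + t • e i ∈ C := by
      refine Filter.eventually_all.2 fun i => ?_
      have hc : ContinuousAt (fun t : ℝ => a + t • e i) 0 := by fun_prop
      have := hc.preimage_mem_nhds (t := C) (by simpa using mem_interior_iff_mem_nhds.1 ha)
      exact nhdsWithin_le_nhds this
    obtain ⟨t, ht, ht0⟩ := (hev.and self_mem_nhdsWithin).exists
    have ht0 : 0 < t := ht0
    refine lt_of_lt_of_le ?_ (hmax (show (fun i => a + t • e i) ∈ _ from fun i _ => ht i))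
    simp only [add_sub_cancel_left]
    have : e.det (fun i => t • e i) = t ^ d := by
      rw [e.det.map_smul_univ (fun _ => t) e, e.det_self]
      simp
    rw [this]
    positivity
  set u : Fin d → Eucl d := fun i => w i - a
  obtain ⟨hli, hsp⟩ := e.is_basis_iff_det.2 (isUnit_iff_ne_zero.2 (abs_pos.1 hpos))
  refine ⟨Module.Basis.mk hli hsp.ge, fun i => ?_, fun y hy i => ?_⟩
  · simpa [u] using hw i trivial
  -- Cramer's rule: a coordinate is the ratio of the determinant with one vertex replaced to the
  -- maximal one.
  · have h1 := congrArg (fun f => f (y - a)) (e.det_smul_mk_coord_eq_det_update hli hsp.ge i)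
    simp only [LinearMap.smul_apply, smul_eq_mul, Module.Basis.coord_apply,
      MultilinearMap.toLinearMap_apply, AlternatingMap.coe_multilinearMap] at h1
    have h2 : Function.update u i (y - a) = fun j => Function.update w i y j - a := by
      ext1 j
      rcases eq_or_ne j i with rfl | hj
      · simp
      · simp [hj, u]
    have h3 : |e.det fun j => Function.update w i y j - a| ≤ |e.det u| := by
      refine hmax (show Function.update w i y ∈ _ from fun j _ => ?_)
      rcases eq_or_ne j i with rfl | hj
      · simpa using hy
      · simpa [hj] using hw j trivial
    rw [← h2, ← h1, abs_mul] at h3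
    rw [Module.Basis.equivFun_apply]
    exact le_of_mul_le_mul_left (by simpa using h3) hpos

/-- Every convex body is, up to a linear map and a translation, sandwiched between two cubes of
side ratio `4 d`. -/
theorem IsConvexBody.exists_cube_coordinates {d : ℕ} (hd : 1 ≤ d) {C : Set (Eucl d)}
    (hC : IsConvexBody C) :
    ∃ (c : Eucl d) (L : Eucl d ≃ₗ[ℝ] (Fin d → ℝ)),
      (∀ v, ‖L v‖ ≤ 1 → c + v ∈ C) ∧ ∀ v, c + v ∈ C → ‖L v‖ ≤ 4 * d := by
  obtain ⟨a, ha⟩ := hC.interior_nonempty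
  obtain ⟨b, hb, hbC⟩ := hC.exists_basis ha
  have hd1 : (1 : ℝ) ≤ d := by exact_mod_cast hd
  have hd0 : (0 : ℝ) < 2 * d := by linarith
  -- Centre of the cube `[0, 1/d]^d`, which lies in the simplex.
  set g : Eucl d := b.equivFun.symm fun _ => 1 / (2 * d)
  have hg : b.equivFun g = fun _ => 1 / (2 * (d : ℝ)) := b.equivFun.apply_symm_apply _
  refine ⟨a + g, b.equivFun.trans (LinearEquiv.smulOfNeZero ℝ _ (2 * (d : ℝ)) hd0.ne'),
    fun v hv => ?_, fun v hv => ?_⟩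
  · have hv' : ∀ i, |b.equivFun v i| ≤ 1 / (2 * d) := by
      intro i
      have h1 := (norm_le_pi_norm _ i).trans hv
      simp only [LinearEquiv.trans_apply, LinearEquiv.smulOfNeZero_apply, Pi.smul_apply,
        smul_eq_mul, Real.norm_eq_abs, abs_mul, abs_of_pos hd0] at h1
      rw [le_div_iff₀ hd0]
      linarith
    set t : Fin d → ℝ := b.equivFun (g + v)
    have ht : ∀ i, t i = 1 / (2 * d) + b.equivFun v i := fun i => by
      simp only [t, map_add, hg, Pi.add_apply]
    have ht0 : ∀ i, 0 ≤ t i := fun i => by rw [ht]; linarith [neg_abs_le (b.equivFun v i), hv' i]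
    have ht1 : ∑ i, t i ≤ 1 := by
      have : ∀ i ∈ Finset.univ, t i ≤ 1 / d := fun i _ => by
        have h2 : (1 : ℝ) / d = 1 / (2 * d) + 1 / (2 * d) := by field_simp; norm_num
        rw [ht, h2]; linarith [le_abs_self (b.equivFun v i), hv' i]
      refine (Finset.sum_le_card_nsmul _ _ _ this).trans ?_
      rw [Finset.card_univ, Fintype.card_fin, nsmul_eq_mul]
      field_simp
      exact le_rfl
    have hsum : a + g + v = ∑ o : Option (Fin d),
        (o.elim (1 - ∑ i, t i) t) • (o.elim a fun i => a + b i) := by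
      rw [Fintype.sum_option]
      simp only [Option.elim, smul_add, Finset.sum_add_distrib, ← Finset.sum_smul]
      rw [← add_assoc, ← add_smul, sub_add_cancel, one_smul, add_assoc]
      congr 1
      exact (b.sum_equivFun (g + v)).symm
    rw [hsum]
    refine hC.convex.sum_mem (fun o _ => ?_) ?_ (fun o _ => ?_)
    · cases o
      · simpa using ht1
      · exact ht0 _
    · rw [Fintype.sum_option]
      simp
    · cases o
      · exact interior_subset ha
      · exact hb _
  · refine (pi_norm_le_iff_of_nonneg (by positivity)).2 fun i => ?_
    have h1 := hbC _ hv i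
    have h2 : a + g + v - a = g + v := by abel
    rw [h2, map_add, hg, Pi.add_apply] at h1
    simp only [LinearEquiv.trans_apply, LinearEquiv.smulOfNeZero_apply, Pi.smul_apply,
      smul_eq_mul, Real.norm_eq_abs, abs_mul, abs_of_pos hd0]
    have h3 : 1 / (2 * (d : ℝ)) ≤ 1 := by rw [div_le_one hd0]; linarith
    have h4 : 0 < 1 / (2 * (d : ℝ)) := by positivity
    have h5 : |b.equivFun v i| ≤ 2 := by
      rw [abs_le] at h1 ⊢
      constructor <;> linarith [h1.1, h1.2]
    nlinarith

theorem IsConvexBody.exists_gauge {d : ℕ} (hd : 1 ≤ d) {C : Set (Eucl d)}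
    (hC : IsConvexBody C) :
    ∃ (p : Eucl d → ℝ) (L : Eucl d ≃ₗ[ℝ] (Fin d → ℝ)),
      IsGaugeLike (4 * d : ℝ) (fun v => p (L.symm v)) ∧ Continuous p ∧
      ∀ x, ∀ r > 0, IsHomothet C {y | p (y - x) ≤ r} ∧
        {y | p (y - x) = r} ⊆ frontier {y | p (y - x) ≤ r} := by
  obtain ⟨c, L, hin, hout⟩ := hC.exists_cube_coordinates hd
  set A : Set (Eucl d) := (fun v => c + v) ⁻¹' C
  have hA : Convex ℝ A := hC.convex.translate_preimage_right c
  have hAc : IsClosed A := hC.isCompact.isClosed.preimage (by fun_prop)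
  have hLc : Continuous L := L.toLinearMap.continuous_of_finiteDimensional
  have hA0 : A ∈ nhds 0 := by
    have : (fun v => ‖L v‖) ⁻¹' Set.Iio 1 ∈ nhds 0 :=
      (hLc.norm.isOpen_preimage _ isOpen_Iio).mem_nhds (by simp)
    exact Filter.mem_of_superset this fun v hv => hin v (le_of_lt hv)
  have hmul : ∀ (t : ℝ) v, 0 ≤ t → gauge A (t • v) = t * gauge A v := fun t v ht => by
    rw [gauge_smul_of_nonneg ht, smul_eq_mul]
  have hcont : Continuous (gauge A) := continuous_gauge hA hA0
  refine ⟨gauge A, L, ⟨fun v w => ?_, fun t v ht => ?_, fun v => ?_, fun v => ?_⟩,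
    hcont, fun x r hr => ⟨⟨r, x - r • c, hr, ?_⟩, fun y hy => ?_⟩⟩
  · rw [map_add]
    exact gauge_add_le hA (absorbent_nhds_zero hA0) _ _
  · rw [map_smul, hmul t _ ht]
  · rcases eq_or_ne v 0 with rfl | hv
    · simp
    have hv0 : 0 < ‖v‖ := norm_pos_iff.2 hv
    refine gauge_le_of_mem hv0.le ⟨‖v‖⁻¹ • L.symm v, hin _ ?_, ?_⟩
    · rw [map_smul, L.apply_symm_apply, norm_smul, norm_inv, norm_norm, inv_mul_cancel₀ hv0.ne']
    · simp [smul_smul, hv0.ne']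
  · have hd0 : (0 : ℝ) < 4 * d := by
      have : (0 : ℝ) < d := by exact_mod_cast hd
      linarith
    rw [← div_le_iff₀' hd0]
    refine le_of_forall_gt fun t ht => ?_
    obtain ⟨s, hs0, hst, w, hw, hwv⟩ := exists_lt_of_gauge_lt (absorbent_nhds_zero hA0) ht
    refine lt_of_le_of_lt ?_ hst
    rw [div_le_iff₀ hd0, ← L.apply_symm_apply v, ← hwv]
    simp only [map_smul, norm_smul, Real.norm_of_nonneg hs0.le]
    exact mul_le_mul_of_nonneg_left (hout w hw) hs0.le
  · have key : ∀ y, gauge A (y - x) ≤ r ↔ c + r⁻¹ • (y - x) ∈ C := by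
      intro y
      have h1 : gauge A (r⁻¹ • (y - x)) ≤ 1 ↔ r⁻¹ • (y - x) ∈ A := by
        rw [gauge_le_one_iff_mem_closure hA hA0, hAc.closure_eq]
      rw [hmul _ _ (inv_nonneg.2 hr.le), inv_mul_le_iff₀ hr, mul_one] at h1
      exact h1
    ext y
    simp only [Set.mem_ofPred_eq, key, Set.mem_image]
    constructor
    · intro h
      refine ⟨_, h, ?_⟩
      rw [smul_add, smul_smul, mul_inv_cancel₀ hr.ne', one_smul]
      abel
    · rintro ⟨w, hw, rfl⟩
      have : c + r⁻¹ • (r • w + (x - r • c) - x) = w := by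
        have : r • w + (x - r • c) - x = r • (w - c) := by rw [smul_sub]; abel
        rw [this, smul_smul, inv_mul_cancel₀ hr.ne', one_smul]
        abel
      rwa [this]
  · have hy : gauge A (y - x) = r := hy
    -- Moving slightly outwards along the ray from `x` makes the gauge exceed `r`.
    refine ⟨subset_closure hy.le, fun hint => ?_⟩
    have hc : ContinuousAt (fun s : ℝ => x + s • (y - x)) 1 := by fun_prop
    have h1 := hc.preimage_mem_nhds (t := {y | gauge A (y - x) ≤ r})
      (by simpa using mem_interior_iff_mem_nhds.1 hint)
    have h2 : ∀ᶠ s : ℝ in nhdsWithin 1 (Set.Ioi 1), gauge A (x + s • (y - x) - x) ≤ r :=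
      nhdsWithin_le_nhds h1
    obtain ⟨s, hs, hs1⟩ := (h2.and self_mem_nhdsWithin).exists
    have hs1 : 1 < s := hs1
    rw [add_sub_cancel_left, hmul s _ (by linarith), hy] at hs
    nlinarith

/-! ### The covering theorem -/

theorem coverNumber_le_card {d : ℕ} {P : Set (Eucl d) → Prop} {A : Set (Eucl d)}
    (m : ℕ) (H : ℕ → Set (Eucl d)) (hP : ∀ i < m, P (H i)) (hA : ∀ y ∈ A, ∃ i < m, y ∈ H i) :
    ∃ n : ℕ, coverNumber P A = n ∧ n ≤ m := by
  have hle : coverNumber P A ≤ m := by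
    refine iInf_le_of_le (H '' Set.Iio m) (iInf_le_of_le ?_ (iInf_le_of_le ?_ ?_))
    · rintro _ ⟨i, hi, rfl⟩
      exact hP i hi
    · intro y hy
      obtain ⟨i, hi, hyi⟩ := hA y hy
      exact ⟨H i, ⟨i, hi, rfl⟩, hyi⟩
    · refine (Set.encard_image_le _ _).trans ?_
      rw [← Finset.coe_range, Set.encard_coe_eq_coe_finsetCard, Finset.card_range]
  obtain ⟨n, hn⟩ := ENat.ne_top_iff_exists.1 (ne_top_of_le_ne_top (ENat.natCast_ne_top m) hle)
  refine ⟨n, hn.symm, ?_⟩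
  rw [← hn] at hle
  exact_mod_cast hle

/-- The common core of the discrete and the continuous covering theorems. -/
theorem exists_coverNumber_bound {d : ℕ} (hd : 1 ≤ d) :
    ∃ c : ℝ, 0 < c ∧ ∀ C : Set (Eucl d), IsConvexBody C → ∀ k : ℝ, 0 < k →
      ∀ μ : Measure (Eucl d), IsFiniteMeasure μ →
        (∀ H, IsHomothet C H → μ (frontier H) ≤ ENNReal.ofReal (k / 2)) →
          ∀ S : Set (Eucl d), Bornology.IsBounded S → μ Sᶜ = 0 →
            ∃ n : ℕ, coverNumber (fun H => IsHomothet C H ∧ μ H ≤ ENNReal.ofReal k) S = n ∧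
              (n : ℝ) ≤ c * max 1 (μ.real Set.univ / k) := by
  have hd0 : (0 : ℝ) < 4 * d := by
    have : (0 : ℝ) < d := by exact_mod_cast hd
    linarith
  obtain ⟨N, hN⟩ := exists_overlap_bound (E := Fin d → ℝ) hd0
  refine ⟨4 * N + 1, by positivity, fun C hC k hk μ hμ hfr S hSb hS => ?_⟩
  obtain ⟨p, L, hp, hpc, hH⟩ := hC.exists_gauge hd
  have hpL : ∀ v, p v ≤ ‖L v‖ := fun v => by simpa using hp.le_norm (L v)
  have hLp : ∀ v, ‖L v‖ ≤ 4 * d * p v := fun v => by simpa using hp.norm_le (L v)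
  have hp0 : ∀ v, 0 ≤ p v := fun v =>
    nonneg_of_mul_nonneg_right ((norm_nonneg _).trans (hLp v)) hd0
  have hpsmul : ∀ (t : ℝ) v, 0 ≤ t → p (t • v) = t * p v := fun t v ht => by
    simpa using hp.smul t (L v) ht
  have hpmeas : ∀ x r, MeasurableSet {y | p (y - x) ≤ r} := fun x r =>
    (isClosed_le (hpc.comp (continuous_sub_right x)) continuous_const).measurableSet
  obtain ⟨B, hB⟩ : ∃ B, ∀ v ∈ S, ‖L v‖ ≤ B := by
    have := (LinearMap.toContinuousLinearMap L.toLinearMap).lipschitz.isBounded_image hSb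
    obtain ⟨B, hB⟩ := isBounded_iff_forall_norm_le.1 this
    exact ⟨B, fun v hv => hB _ ⟨v, hv, rfl⟩⟩
  have hone : (1 : ℝ) ≤ max 1 (μ.real Set.univ / k) := le_max_left _ _
  rcases le_or_gt (μ Set.univ) (ENNReal.ofReal k) with hle | hgt
  · obtain ⟨n, hn, hn1⟩ := coverNumber_le_card (A := S) 1
      (P := fun H => IsHomothet C H ∧ μ H ≤ ENNReal.ofReal k)
      (fun _ => {y | p (y - 0) ≤ max B 1})
      (fun _ _ => ⟨(hH 0 _ (by positivity)).1, (measure_mono (Set.subset_univ _)).trans hle⟩)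
      (fun y hy => ⟨0, one_pos, by
        simpa using Or.inl ((hpL y).trans (hB y hy))⟩)
    refine ⟨n, hn, ?_⟩
    have : (n : ℝ) ≤ 1 := by exact_mod_cast hn1
    nlinarith [(Nat.cast_nonneg N : (0 : ℝ) ≤ N)]
  · have hq : ∀ x, ∃ r, 0 < r ∧ μ {y | p (y - x) ≤ r} ≤ ENNReal.ofReal k ∧
        ENNReal.ofReal (k / 4) ≤ μ {y | p (y - x) ≤ r} := by
      intro x
      have hm : Measurable fun y => p (y - x) := (hpc.comp (continuous_sub_right x)).measurable
      have hmap : ∀ s, MeasurableSet s → μ.map (fun y => p (y - x)) s = μ {y | p (y - x) ∈ s} :=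
        fun s hs => Measure.map_apply hm hs
      obtain ⟨r, hr, h1, h2⟩ := exists_quantile (μ.map fun y => p (y - x)) hk
        (by
          rw [hmap _ measurableSet_Iio]
          simp [not_lt.2 (hp0 _)])
        (fun t => by
          rw [hmap _ (measurableSet_singleton t)]
          rcases lt_trichotomy t 0 with ht | rfl | ht
          · have : {y | p (y - x) ∈ ({t} : Set ℝ)} = ∅ :=
              Set.eq_empty_of_forall_notMem fun y hy => absurd (hp0 (y - x))
                (by rw [show p (y - x) = t from hy]; exact not_le.2 ht)
            rw [this, measure_empty]
            exact zero_le
          -- The atom at `0` is the mass of `{x}`, and `x` lies on the boundary of a translate of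
          -- the unit gauge ball.
          · obtain ⟨v, hv⟩ : ∃ v, p v = 1 := by
              have : Nonempty (Fin d) := ⟨⟨0, hd⟩⟩
              obtain ⟨w, hw⟩ := exists_ne (0 : Eucl d)
              have hw0 : p w ≠ 0 := fun h => hw (by
                have := hLp w
                rw [h, mul_zero, norm_le_zero_iff] at this
                simpa using this)
              exact ⟨(p w)⁻¹ • w, by rw [hpsmul _ _ (inv_nonneg.2 (hp0 w)), inv_mul_cancel₀ hw0]⟩
            refine (measure_mono ?_).trans (hfr _ (hH (x - v) 1 one_pos).1)
            refine Set.Subset.trans (fun y hy => ?_) (hH (x - v) 1 one_pos).2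
            have hy : p (y - x) = 0 := hy
            have hyx := hLp (y - x)
            rw [hy, mul_zero, norm_le_zero_iff] at hyx
            have hyx : y = x := by simpa [sub_eq_zero] using hyx
            simp [hyx, hv]
          · exact (measure_mono (hH x t ht).2).trans (hfr _ (hH x t ht).1))
        (by rwa [hmap _ MeasurableSet.univ])
      rw [hmap _ measurableSet_Iic] at h1 h2
      exact ⟨r, hr, h1, h2⟩
    choose r hr hrk hkr using hq
    -- A homothet of radius above `2 * B` centred in `S` would contain `S`, hence more than `k` of
    -- mass.
    have hbdd : BddAbove (r '' S) := by
      refine ⟨2 * B, ?_⟩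
      rintro _ ⟨x, hx, rfl⟩
      by_contra! h
      refine absurd (hrk x) (not_le.2 (hgt.trans_le ?_))
      have hsub : S ⊆ {y | p (y - x) ≤ r x} := fun y hy => by
        have h1 := (hpL (y - x)).trans_eq (by rw [map_sub])
        have h2 := norm_sub_le (L y) (L x)
        show p (y - x) ≤ r x
        linarith [hB x hx, hB y hy]
      calc μ Set.univ ≤ μ S + μ Sᶜ := by
            rw [← Set.union_compl_self S]; exact measure_union_le _ _
        _ ≤ _ := by rw [hS, add_zero]; exact measure_mono hsub
    set M : ℝ := 4 * N * (μ.real Set.univ / k)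
    have hM : 0 ≤ M := by positivity
    -- One step more than the mass bound `M` allows, so the selection must end by covering `S`.
    obtain ⟨m, x, -, hxS, hxR, hxr, hcov⟩ := exists_greedy_selection S
      (fun x y => p (y - x) ≤ r x) r (fun a _ => hr a) hbdd (⌊M⌋₊ + 1)
    have hsum := sum_measure_le_of_overlap μ (Finset.range m) (fun i => {y | p (y - x i) ≤ r (x i)})
      (fun i _ => hpmeas _ _) N fun z t ht hz =>
        hN _ hp (fun i => L (x i)) (fun i => r (x i)) (L z) t (fun i _ => hr _)
          (fun i hi => by simpa using hz i hi)
          (fun i _ j hj hij => by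
            simpa using hxR i j hij (Finset.mem_range.1 (ht hj)))
          (fun i hi j hj hij => hxr i (Finset.mem_range.1 (ht hi)) _
            (hxS j (Finset.mem_range.1 (ht hj)))
            fun l hl => hxR l j (hl.trans hij) (Finset.mem_range.1 (ht hj)))
    have hmM : (m : ℝ) ≤ M := by
      have h1 := (Finset.card_nsmul_le_sum (Finset.range m) _ _ fun i _ => hkr (x i)).trans hsum
      rw [Finset.card_range, nsmul_eq_mul] at h1
      have h2 := ENNReal.toReal_mono
        (ENNReal.mul_ne_top (ENNReal.natCast_ne_top N) (measure_ne_top μ _)) h1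
      rw [ENNReal.toReal_mul, ENNReal.toReal_mul, ENNReal.toReal_natCast, ENNReal.toReal_natCast,
        ENNReal.toReal_ofReal (by positivity)] at h2
      have h3 : (N : ℝ) * (μ Set.univ).toReal = M * (k / 4) := by
        simp only [M, Measure.real]
        field_simp
      rw [h3] at h2
      exact le_of_mul_le_mul_right h2 (by positivity)
    have hcov' := hcov.resolve_left fun h => by
      have := Nat.lt_floor_add_one M
      rw [h] at hmM
      push_cast at hmM
      linarith
    obtain ⟨n, hn, hnm⟩ := coverNumber_le_card (A := S)
      (P := fun H => IsHomothet C H ∧ μ H ≤ ENNReal.ofReal k) m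
      (fun i => {y | p (y - x i) ≤ r (x i)})
      (fun i _ => ⟨(hH _ _ (hr _)).1, hrk _⟩) hcov'
    refine ⟨n, hn, ?_⟩
    have hnm : (n : ℝ) ≤ m := by exact_mod_cast hnm
    have h4 : M ≤ 4 * N * max 1 (μ.real Set.univ / k) := by
      simp only [M]
      gcongr
      exact le_max_right _ _
    linarith

theorem mainTheorem1 (d : ℕ) (hd : 1 ≤ d) :
    ∃ c : ℝ, 0 < c ∧
      (∀ C : Set (Eucl d), IsConvexBody C →
        ∀ k : ℕ, 0 < k → ∀ S : Finset (Eucl d), NonDegenerate ((k : ℝ) / 2) C S →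
          ∃ n : ℕ, fPoints C k S = n ∧ (n : ℝ) ≤ c * max 1 ((S.card : ℝ) / k)) ∧
      (∀ C : Set (Eucl d), IsConvexBody C →
        ∀ k : ℝ, 0 < k → ∀ μ : Measure (Eucl d), IsNice C μ →
          ∀ K : Set (Eucl d), IsBall K → μ K = μ Set.univ →
            ∃ n : ℕ, fMeasure C k μ K = n ∧ (n : ℝ) ≤ c * max 1 (μ.real Set.univ / k)) := by
  obtain ⟨c, hc, hcov⟩ := exists_coverNumber_bound hd
  refine ⟨c, hc, fun C hC k hk S hS => ?_, fun C hC k hk μ hμ K hK hμK => ?_⟩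
  · have hSm : MeasurableSet (S : Set (Eucl d)) := S.measurableSet
    set ν : Measure (Eucl d) := Measure.count.restrict (S : Set (Eucl d))
    have hν : ∀ H, ν H = (((S : Set (Eucl d)) ∩ H).ncard : ENNReal) := fun H => by
      have hfin : (H ∩ (S : Set (Eucl d))).Finite := S.finite_toSet.inter_of_right H
      rw [Measure.restrict_apply' hSm, Set.inter_comm (S : Set (Eucl d)) H,
        Measure.count_apply_finite _ hfin, Set.ncard_eq_toFinset_card _ hfin]
    have hνu : ν Set.univ = (S.card : ENNReal) := by
      rw [hν, Set.inter_univ, Set.ncard_coe_finset]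
    have hkR : (0 : ℝ) < k := by exact_mod_cast hk
    have := hcov C hC k hkR ν ⟨by rw [hνu]; exact ENNReal.natCast_lt_top _⟩
      (fun H hH => by
        rw [hν, ← ENNReal.ofReal_natCast]
        exact ENNReal.ofReal_le_ofReal (hS H hH))
      S S.finite_toSet.isBounded (by rw [hν]; simp)
    rw [Measure.real, hνu, ENNReal.toReal_natCast] at this
    simpa only [fPoints, hν, ENNReal.ofReal_natCast, Nat.cast_le] using this
  · have hKm : MeasurableSet K ∧ Bornology.IsBounded K := by
      obtain ⟨x, r, -, rfl | rfl⟩ := hK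
      · exact ⟨measurableSet_ball, Metric.isBounded_ball⟩
      · exact ⟨measurableSet_closedBall, Metric.isBounded_closedBall⟩
    have hfin : IsFiniteMeasure μ := ⟨hμ.finite⟩
    exact hcov C hC k hk μ hfin (fun H hH => by rw [hμ.frontier_null H hH]; exact zero_le)
      K hKm.2 (by rw [measure_compl hKm.1 (measure_ne_top μ K), hμK, tsub_self])
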